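/- A translation surface is a compact connected Hausdorff space $X$ together with a finite set $\Sigma\subset X$ and an atlas of charts $X\setminus\Sigma\supset U\to\mathbb C$ covering $X\setminus\Sigma$ whose transition maps are locally translations, such that every $p\in\Sigma$ has a chart $\psi$ of $X$ centred at $p$ (i.e. $\psi(p)=0$) in which the translation charts read locally $z\mapsto z^k+c$ for some integer $k\ge 1$ depending only on $p$. Its genus is $g=\tfrac12\operatorname{rank}H_1(X;\mathbb Z)$. Its Veech group is the group $\Gamma$ of all $A\in \mathrm{GL}_2^+(\mathbb R)$ such that some homeomorphism $f$ of $X$ carries the maximal translation atlas $\{A\circ\varphi\}$ of $A\cdot X$ onto the maximal translation atlas $\{\varphi\}$ of $X$; here $A$ acts linearly on $\mathbb C=\mathbb R^2$, and the maximal translation atlas consists of all charts of $X$ that differ locally by translations from the given translation charts. The trace field $K(\Gamma)$ is the subfield of $\mathbb R$ generated by the traces of the elements of $\Gamma$. Lemma. If $\Gamma$ is the Veech group of a translation surface of genus two, then there is an integer $d\ge 1$ such that $$K(\Gamma)=\mathbb Q[\sqrt d].$$ (In particular, $K(\Gamma)$ is $\mathbb Q$, when $d$ is a square, or a real quadratic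 field.) -/

import Mathlib

open scoped MatrixGroups Topology IntermediateField

universe u

/-- A translation structure on a topological space `X` (a translation surface is a compact connected
Hausdorff space with such a structure): a finite set `sing ⊆ X` and charts with values in `ℂ` which
cover `X ∖ sing` and whose transition maps are locally translations, such that every point of `sing`
has a chart `ψ`, centred at that point, in which the translation charts read `z ↦ z ^ k + c`,
where `2πk` is the cone angle (`k = 1` is allowed and gives a removable point). -/
structure TranslationStructure (X : Type u) [TopologicalSpace X] where
  /-- the singular set -/
  sing : Set X
  finite_sing : sing.Finite
  /-- the translation charts -/
  atlas : Set (OpenPartialHomeomorph X ℂ)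
  disjoint_sing : ∀ e ∈ atlas, Disjoint e.source sing
  cover : ∀ x, x ∉ sing → ∃ e ∈ atlas, x ∈ e.source
  translation : ∀ e ∈ atlas, ∀ e' ∈ atlas, ∀ x ∈ e.source ∩ e'.source,
    ∃ c : ℂ, ∀ᶠ y in 𝓝 x, e' y = e y + c
  conical : ∀ p ∈ sing, ∃ (ψ : OpenPartialHomeomorph X ℂ) (k : ℕ), 1 ≤ k ∧ p ∈ ψ.source ∧ ψ p = 0 ∧
    ∀ e ∈ atlas, ∀ x ∈ ψ.source ∩ e.source, ∃ c : ℂ, ∀ᶠ y in 𝓝 x, e y = ψ y ^ k + c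

namespace TranslationStructure

variable {X : Type u} [TopologicalSpace X]

/-- The maximal translation atlas: all charts of `X` that differ locally by translations from the
translation charts. It does not see removable points of `sing`, and no chart in it is defined at
a point whose cone angle exceeds `2π`. -/
def maximalAtlas (T : TranslationStructure X) : Set (OpenPartialHomeomorph X ℂ) :=
  {φ | ∀ e ∈ T.atlas, ∀ x ∈ φ.source ∩ e.source, ∃ c : ℂ, ∀ᶠ y in 𝓝 x, φ y = e y + c}

end TranslationStructure

/-- The linear action of a real `2 × 2` matrix on `ℂ = ℝ²`. -/
def planeMap (A : Matrix (Fin 2) (Fin 2) ℝ) (z : ℂ) : ℂ :=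
  ⟨A 0 0 * z.re + A 0 1 * z.im, A 1 0 * z.re + A 1 1 * z.im⟩

theorem planeMap_one (z : ℂ) : planeMap 1 z = z := by
  apply Complex.ext <;> simp [planeMap]

theorem planeMap_mul (A B : Matrix (Fin 2) (Fin 2) ℝ) (z : ℂ) :
    planeMap (A * B) z = planeMap A (planeMap B z) := by
  apply Complex.ext <;> simp [planeMap, Matrix.mul_apply, Fin.sum_univ_two] <;> ring

theorem continuous_planeMap (A : Matrix (Fin 2) (Fin 2) ℝ) : Continuous (planeMap A) := by
  have h : planeMap A = fun z : ℂ => ((A 0 0 * z.re + A 0 1 * z.im : ℝ) : ℂ) +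
      ((A 1 0 * z.re + A 1 1 * z.im : ℝ) : ℂ) * Complex.I := by
    funext z
    apply Complex.ext <;> simp [planeMap]
  rw [h]
  fun_prop

/-- The homeomorphism of `ℂ = ℝ²` given by an element of `GL₂⁺(ℝ)`. -/
noncomputable def planeHomeomorph (A : GL(2, ℝ)⁺) : ℂ ≃ₜ ℂ where
  toFun := planeMap (A : GL (Fin 2) ℝ)
  invFun := planeMap ((A⁻¹ : GL(2, ℝ)⁺) : GL (Fin 2) ℝ)
  left_inv z := by
    rw [← planeMap_mul, ← Units.val_mul, ← Subgroup.coe_mul, inv_mul_cancel]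
    exact planeMap_one z
  right_inv z := by
    rw [← planeMap_mul, ← Units.val_mul, ← Subgroup.coe_mul, mul_inv_cancel]
    exact planeMap_one z
  continuous_toFun := continuous_planeMap _
  continuous_invFun := continuous_planeMap _

/-- The chart `A ∘ φ ∘ f⁻¹`: the chart `A ∘ φ` of the surface `A • X`, transported to `X` by
the homeomorphism `f`. -/
noncomputable def transportChart {X : Type u} [TopologicalSpace X] (A : GL(2, ℝ)⁺) (f : X ≃ₜ X)
    (φ : OpenPartialHomeomorph X ℂ) : OpenPartialHomeomorph X ℂ :=
  (f.symm.transOpenPartialHomeomorph φ).transHomeomorph (planeHomeomorph A)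

theorem transportChart_one {X : Type u} [TopologicalSpace X] (φ : OpenPartialHomeomorph X ℂ) :
    transportChart 1 (Homeomorph.refl X) φ = φ := by
  ext z
  · exact planeMap_one _
  · change φ.symm (planeMap _ z) = φ.symm z
    rw [inv_one]
    exact congrArg _ (planeMap_one z)
  · rfl

theorem transportChart_mul {X : Type u} [TopologicalSpace X] (A B : GL(2, ℝ)⁺) (f g : X ≃ₜ X)
    (φ : OpenPartialHomeomorph X ℂ) :
    transportChart (A * B) (g.trans f) φ = transportChart A f (transportChart B g φ) := by
  ext z
  · exact planeMap_mul _ _ _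
  · change f (g (φ.symm (planeMap _ z))) = f (g (φ.symm (planeMap _ (planeMap _ z))))
    rw [← planeMap_mul, mul_inv_rev]
    rfl
  · rfl

namespace TranslationStructure

variable {X : Type u} [TopologicalSpace X]

/-- The Veech group: all `A ∈ GL₂⁺(ℝ)` such that `A • X` and `X` are the same translation surface,
i.e. such that some homeomorphism `f` of `X` carries the maximal translation atlas `{A ∘ φ}`
of `A • X` onto that of `X`. Such an `f` is an affine homeomorphism with derivative `A`. -/
def veechGroup (T : TranslationStructure X) : Subgroup GL(2, ℝ)⁺ where
  carrier := {A | ∃ f : X ≃ₜ X, ∀ φ : OpenPartialHomeomorph X ℂ,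
    transportChart A f φ ∈ T.maximalAtlas ↔ φ ∈ T.maximalAtlas}
  one_mem' := ⟨Homeomorph.refl X, fun φ => by rw [transportChart_one]⟩
  mul_mem' := by
    rintro A B ⟨f, hf⟩ ⟨g, hg⟩
    exact ⟨g.trans f, fun φ => by rw [transportChart_mul, hf, hg]⟩
  inv_mem' := by
    rintro A ⟨f, hf⟩
    refine ⟨f.symm, fun φ => ?_⟩
    rw [← hf, ← transportChart_mul, mul_inv_cancel, Homeomorph.symm_trans_self,
      transportChart_one]

end TranslationStructure

/-- The first singular homology group `H₁(X; ℤ)`. -/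
noncomputable def singularH1 (X : Type u) [TopologicalSpace X] : ModuleCat.{u} ℤ :=
  ((AlgebraicTopology.singularHomologyFunctor (ModuleCat.{u} ℤ) 1).obj
    (ModuleCat.of ℤ (ULift.{u} ℤ))).obj (TopCat.of X)

/-- A compact connected orientable surface has genus `g` if its first Betti number is `2g`. -/
def HasGenus (X : Type u) [TopologicalSpace X] (g : ℕ) : Prop :=
  Module.finrank ℤ (singularH1 X) = 2 * g

/-- The trace field of a group of real `2 × 2` matrices: the subfield of `ℝ` generated by the traces
of its elements. -/
noncomputable def traceField (Γ : Subgroup GL(2, ℝ)⁺) : IntermediateField ℚ ℝ :=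
  IntermediateField.adjoin ℚ
    {t : ℝ | ∃ A ∈ Γ, t = Matrix.trace ((A : GL (Fin 2) ℝ) : Matrix (Fin 2) (Fin 2) ℝ)}

/-! Let L be the rational span of the periods of the surface, the values on `H₁(X; ℤ)` of the
holonomy homomorphism to `ℂ`. Genus two gives `dim L ≤ 4`. An affine homeomorphism with derivative A
acts on homology, and A carries the period of a class to the period of its image
(`planeMap_mem_range_period`); hence A and its inverse preserve L. Area is finite, positive and
scaled by `det A`, so `det A = 1` (`det_eq_one`), and Cayley–Hamilton turns `A + A⁻¹` into
multiplication by `tr A`. All traces therefore lie in the field K of real numbers t with `tL ⊆ L`.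

The periods are not contained in a real line, by a maximum principle (`exists_period_ne_zero`). Two
periods v, w independent over `ℝ` embed `K × K` in L by `(s, t) ↦ sv + tw`, so `2 [K : ℚ] ≤ 4`. A
real field of degree at most two is `ℚ(√d)`.

Instead of integrating a one-form, holonomy uses local primitives: translation charts at regular
points, `ψ ^ k` at cone points. They form a covering space with fibre `ℂ`, so they lift along every
singular simplex; end-point differences give a singular cocycle. -/

section

open Filter Set

/-! ### Local primitives of the translation structure -/

namespace TranslationStructure

variable {X : Type u} [TopologicalSpace X]

/-- `F` is a primitive of the translation structure at `x`: it is continuous at `x` and, near `x`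
but off `x`, it differs from the translation charts by locally constant functions. -/
def IsPrimitiveAt (T : TranslationStructure X) (F : X → ℂ) (x : X) : Prop :=
  ContinuousAt F x ∧ ∀ᶠ y in 𝓝[≠] x, ∀ e ∈ T.atlas, y ∈ e.source →
    ∃ c : ℂ, ∀ᶠ z in 𝓝 y, F z = e z + c

theorem exists_chart (T : TranslationStructure X) (x : X) :
    ∃ ψ : OpenPartialHomeomorph X ℂ, x ∈ ψ.source := by
  by_cases hx : x ∈ T.sing
  · obtain ⟨ψ, k, -, h, -⟩ := T.conical x hx
    exact ⟨ψ, h⟩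
  · obtain ⟨e, -, h⟩ := T.cover x hx
    exact ⟨e, h⟩

theorem eventually_notMem_sing [T1Space X] (T : TranslationStructure X) (x : X) :
    ∀ᶠ y in 𝓝[≠] x, y ∉ T.sing := by
  have h : (T.sing \ {x})ᶜ ∈ 𝓝 x :=
    (T.finite_sing.subset sdiff_subset).isClosed.isOpen_compl.mem_nhds (by simp)
  filter_upwards [nhdsWithin_le_nhds h, self_mem_nhdsWithin] with y hy hyx hs
  exact hy ⟨hs, hyx⟩

theorem isPreconnected_ball_diff_center {c : ℂ} {r : ℝ} (hr : 0 < r) :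
    IsPreconnected (Metric.ball c r \ {c}) := by
  have h := (isConnected_compl_singleton_of_one_lt_rank (E := ℂ) (by simp) 0).isPreconnected.image
    (OpenPartialHomeomorph.univBall c r) (OpenPartialHomeomorph.continuous_univBall c r).continuousOn
  convert h using 1
  have hb : Metric.ball c r = OpenPartialHomeomorph.univBall c r '' univ := by
    rw [← OpenPartialHomeomorph.univBall_target c hr, ← OpenPartialHomeomorph.univBall_source c r]
    exact ((OpenPartialHomeomorph.univBall c r).image_source_eq_target).symm
  have hinj : Function.Injective (OpenPartialHomeomorph.univBall c r) := by
    have := (OpenPartialHomeomorph.univBall c r).injOn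
    rwa [OpenPartialHomeomorph.univBall_source, injOn_univ] at this
  have h0 : ({c} : Set ℂ) = OpenPartialHomeomorph.univBall c r '' {0} := by simp
  rw [compl_eq_univ_sdiff, image_sdiff hinj, ← hb, ← h0]

/-- Every point has a basis of neighbourhoods that are connected after removal of the point. -/
theorem exists_isPreconnected_punctured (T : TranslationStructure X) {x : X} {s : Set X}
    (hs : s ∈ 𝓝 x) : ∃ V ⊆ s, IsOpen V ∧ x ∈ V ∧ IsPreconnected (V \ {x}) ∧ (V \ {x}).Nonempty ∧
      x ∈ closure (V \ {x}) := by
  obtain ⟨ψ, hx⟩ := T.exists_chart x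
  have ht : ψ.target ∩ ψ.symm ⁻¹' s ∈ 𝓝 (ψ x) :=
    inter_mem (ψ.open_target.mem_nhds (ψ.map_source hx))
      ((ψ.continuousAt_symm (ψ.map_source hx)) (by rwa [ψ.left_inv hx]))
  obtain ⟨r, hr, hball⟩ := Metric.mem_nhds_iff.1 ht
  have hVt : Metric.ball (ψ x) r ⊆ ψ.target := hball.trans inter_subset_left
  have himage : ψ.symm '' Metric.ball (ψ x) r \ {x} = ψ.symm '' (Metric.ball (ψ x) r \ {ψ x}) := by
    ext y
    constructor
    · rintro ⟨⟨z, hz, rfl⟩, hne⟩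
      refine ⟨z, ⟨hz, fun h => hne ?_⟩, rfl⟩
      rw [mem_singleton_iff] at h ⊢
      rw [h, ψ.left_inv hx]
    · rintro ⟨z, ⟨hz, hne⟩, rfl⟩
      refine ⟨⟨z, hz, rfl⟩, fun h => hne ?_⟩
      rw [mem_singleton_iff] at h ⊢
      rw [← h, ψ.right_inv (hVt hz)]
  have hcont : ContinuousOn ψ.symm (Metric.ball (ψ x) r) := ψ.continuousOn_symm.mono hVt
  have hcl : ψ x ∈ closure (Metric.ball (ψ x) r \ {ψ x}) := by
    rw [mem_closure_iff_frequently]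
    have h1 : ∃ᶠ z in 𝓝[≠] (ψ x), z ∈ Metric.ball (ψ x) r \ {ψ x} := by
      refine Eventually.frequently ?_
      filter_upwards [nhdsWithin_le_nhds (Metric.ball_mem_nhds _ hr), self_mem_nhdsWithin]
        with z h1 h2 using ⟨h1, h2⟩
    exact h1.filter_mono nhdsWithin_le_nhds
  refine ⟨ψ.symm '' Metric.ball (ψ x) r, ?_, ?_, ⟨ψ x, Metric.mem_ball_self hr, ψ.left_inv hx⟩,
    ?_, ?_, ?_⟩
  · rintro _ ⟨z, hz, rfl⟩
    exact (hball hz).2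
  · exact ψ.symm.isOpen_image_of_subset_source Metric.isOpen_ball hVt
  · rw [himage]
    exact (isPreconnected_ball_diff_center hr).image _ (hcont.mono sdiff_subset)
  · rw [himage]
    exact (closure_nonempty_iff.1 ⟨_, hcl⟩).image _
  · rw [himage]
    have h1 : ContinuousWithinAt ψ.symm (Metric.ball (ψ x) r \ {ψ x}) (ψ x) :=
      (hcont _ (Metric.mem_ball_self hr)).mono sdiff_subset
    simpa [ψ.left_inv hx] using h1.mem_closure_image hcl

/-- Off x, both functions differ from charts by local constants, so their difference is locally
constant on a punctured neighbourhood, which can be chosen connected. Continuity at x extends the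
constancy to x, even at a cone point. -/
theorem IsPrimitiveAt.sub_eventuallyConst [T1Space X] {T : TranslationStructure X} {F G : X → ℂ}
    {x : X} (hF : T.IsPrimitiveAt F x) (hG : T.IsPrimitiveAt G x) :
    ∃ c : ℂ, ∀ᶠ y in 𝓝 x, F y = G y + c := by
  obtain ⟨hFc, hF⟩ := hF
  obtain ⟨hGc, hG⟩ := hG
  have hloc : ∀ᶠ y in 𝓝[≠] x, ∃ c : ℂ, ∀ᶠ z in 𝓝 y, F z - G z = c := by
    filter_upwards [hF, hG, T.eventually_notMem_sing x] with y h1 h2 h3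
    obtain ⟨e, he, hy⟩ := T.cover y h3
    obtain ⟨c1, h1⟩ := h1 e he hy
    obtain ⟨c2, h2⟩ := h2 e he hy
    refine ⟨c1 - c2, ?_⟩
    filter_upwards [h1, h2] with z h1 h2
    rw [h1, h2]; ring
  rw [eventually_nhdsWithin_iff] at hloc
  obtain ⟨V, hVs, hVo, hxV, hVp, ⟨y0, hy0⟩, hcl⟩ := T.exists_isPreconnected_punctured hloc
  have hconst : ∀ y ∈ V \ {x}, F y - G y = F y0 - G y0 := by
    intro y hy
    refine hVp.induction₂ (fun a b => F a - G a = F b - G b) ?_ (fun _ _ _ _ _ _ h h' => h.trans h')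
      (fun _ _ _ _ h => h.symm) hy hy0
    intro a ha
    obtain ⟨c, hc⟩ := hVs ha.1 ha.2
    filter_upwards [nhdsWithin_le_nhds hc] with z hz
    rw [hz, hc.self_of_nhds]
  refine ⟨F y0 - G y0, ?_⟩
  have hx0 : F x - G x = F y0 - G y0 := by
    have h1 : ContinuousWithinAt (fun y => F y - G y) (V \ {x}) x :=
      (hFc.sub hGc).continuousWithinAt
    have := h1.mem_closure_image hcl
    rw [Set.image_congr (g := fun _ => F y0 - G y0) hconst] at this
    simpa [Set.Nonempty.image_const ⟨y0, hy0⟩] using this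
  filter_upwards [hVo.mem_nhds hxV] with y hy
  by_cases h : y = x
  · subst h; rw [← hx0]; ring
  · rw [← hconst y ⟨hy, h⟩]; ring

theorem IsPrimitiveAt.of_eventuallyEq {T : TranslationStructure X} {F : X → ℂ}
    {e : OpenPartialHomeomorph X ℂ} (he : e ∈ T.atlas) {x : X} (hx : x ∈ e.source) {c : ℂ}
    (h : ∀ᶠ y in 𝓝 x, F y = e y + c) : T.IsPrimitiveAt F x := by
  constructor
  · have : ContinuousAt (fun y => e y + c) x := (e.continuousAt hx).add_const c
    exact this.congr (by filter_upwards [h] with y hy using hy.symm)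
  · refine nhdsWithin_le_nhds ?_
    filter_upwards [h.eventually_nhds, e.open_source.mem_nhds hx] with y h1 hy e' he' hy'
    obtain ⟨d, hd⟩ := T.translation e he e' he' y ⟨hy, hy'⟩
    refine ⟨c - d, ?_⟩
    filter_upwards [h1, hd] with z h1 h2
    rw [h1, h2]; ring

theorem IsPrimitiveAt.eventually [T1Space X] {T : TranslationStructure X} {F : X → ℂ} {x : X}
    (hF : T.IsPrimitiveAt F x) : ∀ᶠ y in 𝓝 x, T.IsPrimitiveAt F y := by
  have h : ∀ᶠ y in 𝓝[≠] x, T.IsPrimitiveAt F y := by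
    filter_upwards [hF.2, T.eventually_notMem_sing x] with y h1 h2
    obtain ⟨e, he, hy⟩ := T.cover y h2
    obtain ⟨c, hc⟩ := h1 e he hy
    exact .of_eventuallyEq he hy hc
  rw [eventually_nhdsWithin_iff] at h
  filter_upwards [h] with y hy
  by_cases hyx : y = x
  · exact hyx ▸ hF
  · exact hy hyx

/-- Open mapping theorem for the nonconstant map `z ^ k`. Openness of primitives at cone points is
what the maximum principle later needs. -/
theorem nhds_pow_le {k : ℕ} (hk : 1 ≤ k) : 𝓝 (0 : ℂ) ≤ map (fun z : ℂ => z ^ k) (𝓝 0) := by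
  have han : AnalyticAt ℂ (fun z : ℂ => z ^ k) 0 := by fun_prop
  rcases han.eventually_constant_or_nhds_le_map_nhds with h | h
  · exfalso
    have h2 : ∀ᶠ z in 𝓝[≠] (0 : ℂ), False := by
      filter_upwards [nhdsWithin_le_nhds h, self_mem_nhdsWithin] with z hz hz0
      rw [zero_pow (by omega)] at hz
      exact hz0 (pow_eq_zero_iff (by omega) |>.1 hz)
    simp [NeBot.ne] at h2
  · simpa [zero_pow (show k ≠ 0 by omega)] using h

/-- Primitives exist at every point, and may be taken open there. -/
theorem exists_isPrimitiveAt (T : TranslationStructure X) (x : X) :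
    ∃ F : X → ℂ, T.IsPrimitiveAt F x ∧ 𝓝 (F x) ≤ map F (𝓝 x) := by
  by_cases hx : x ∈ T.sing
  · obtain ⟨ψ, k, hk, hxψ, h0, h⟩ := T.conical x hx
    refine ⟨fun y => ψ y ^ k, ⟨(ψ.continuousAt hxψ).pow k, nhdsWithin_le_nhds ?_⟩, ?_⟩
    · filter_upwards [ψ.open_source.mem_nhds hxψ] with y hy e he hye
      obtain ⟨c, hc⟩ := h e he y ⟨hy, hye⟩
      refine ⟨-c, ?_⟩
      filter_upwards [hc] with z hz
      rw [hz]; ring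
    · have h1 : map (fun y => ψ y ^ k) (𝓝 x) = map (fun z : ℂ => z ^ k) (map ψ (𝓝 x)) := by
        rw [map_map]; rfl
      simp only [h1, ψ.map_nhds_eq hxψ, h0, zero_pow (show k ≠ 0 by omega)]
      exact nhds_pow_le hk
  · obtain ⟨e, he, hxe⟩ := T.cover x hx
    exact ⟨e, .of_eventuallyEq he hxe (c := 0) (by simp), (e.map_nhds_eq hxe).ge⟩

theorem atlas_subset_maximalAtlas (T : TranslationStructure X) : T.atlas ⊆ T.maximalAtlas := by
  intro e he e' he' x hx
  exact T.translation e' he' e he x hx.symm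

theorem planeMap_add (A : Matrix (Fin 2) (Fin 2) ℝ) (z w : ℂ) :
    planeMap A (z + w) = planeMap A z + planeMap A w := by
  apply Complex.ext <;> simp [planeMap] <;> ring

/-- Affine homeomorphisms transport primitives to primitives. -/
theorem IsPrimitiveAt.transport [T1Space X] {T : TranslationStructure X} {A : GL(2, ℝ)⁺}
    {f : X ≃ₜ X}
    (hf : ∀ φ ∈ T.maximalAtlas, transportChart A f φ ∈ T.maximalAtlas) {F : X → ℂ} {x : X}
    (hF : T.IsPrimitiveAt F x) :
    T.IsPrimitiveAt (fun y => planeMap (A : GL (Fin 2) ℝ) (F (f.symm y))) (f x) := by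
  constructor
  · refine (continuous_planeMap _).continuousAt.comp ?_
    refine ContinuousAt.comp (g := F) (f := f.symm) ?_ f.symm.continuous.continuousAt
    simpa using hF.1
  · have ht : Tendsto f.symm (𝓝[≠] (f x)) (𝓝[≠] x) := by
      have := f.symm.continuous.continuousAt (x := f x)
      refine tendsto_nhdsWithin_of_tendsto_nhds_of_eventually_within _
        (tendsto_nhdsWithin_of_tendsto_nhds (by simpa [ContinuousAt] using this)) ?_
      filter_upwards [self_mem_nhdsWithin] with y hy h
      exact hy (by rw [mem_singleton_iff] at h ⊢; rw [← h]; simp)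
    filter_upwards [ht.eventually hF.2, ht.eventually (T.eventually_notMem_sing x)]
      with y h1 h2 e' he' hy'
    obtain ⟨e, he, hy⟩ := T.cover _ h2
    obtain ⟨c, hc⟩ := h1 e he hy
    obtain ⟨d, hd⟩ := hf e (T.atlas_subset_maximalAtlas he) e' he' y ⟨hy, hy'⟩
    refine ⟨d + planeMap (A : GL (Fin 2) ℝ) c, ?_⟩
    filter_upwards [hd, f.symm.continuous.continuousAt.eventually hc] with z h3 h4
    rw [h4, planeMap_add, ← add_assoc, ← h3]
    rfl

end TranslationStructure

/-! ### The covering space of primitives and lifting along maps -/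

/-- The complex numbers with the discrete topology. -/
def DiscreteComplex : Type := ℂ

instance : TopologicalSpace DiscreteComplex := ⊥

instance : DiscreteTopology DiscreteComplex := ⟨rfl⟩

namespace TranslationStructure

variable {X : Type u} [TopologicalSpace X]

/-- A chosen primitive at each point of `X`. -/
noncomputable def primitive (T : TranslationStructure X) (x : X) : X → ℂ :=
  (T.exists_isPrimitiveAt x).choose

theorem isPrimitiveAt_primitive (T : TranslationStructure X) (x : X) :
    T.IsPrimitiveAt (T.primitive x) x :=
  (T.exists_isPrimitiveAt x).choose_spec.1

theorem nhds_le_map_primitive (T : TranslationStructure X) (x : X) :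
    𝓝 (T.primitive x x) ≤ map (T.primitive x) (𝓝 x) :=
  (T.exists_isPrimitiveAt x).choose_spec.2

/-- The covering of `X` with fibre `ℂ` whose sections are the primitives. -/
noncomputable def primitiveCore [T1Space X] (T : TranslationStructure X) :
    FiberBundleCore X X DiscreteComplex where
  baseSet i := interior {x | T.IsPrimitiveAt (T.primitive i) x}
  isOpen_baseSet i := isOpen_interior
  indexAt x := x
  mem_baseSet_at x := mem_interior_iff_mem_nhds.2 (T.isPrimitiveAt_primitive x).eventually
  -- In the trivialization i, the label v at x stands for the germ of primitive with value `v +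
  -- T.primitive i x` there; changing trivialization keeps this value.
  coordChange i j x v := (show ℂ from v) + T.primitive i x - T.primitive j x
  coordChange_self i x _ v := add_sub_cancel_right (G := ℂ) v _
  coordChange_comp i j k x _ v := by
    change (show ℂ from v) + _ - _ + _ - _ = (show ℂ from v) + _ - _
    ring
  continuousOn_coordChange i j := by
    rintro ⟨x, v⟩ ⟨⟨hi, hj⟩, -⟩
    refine ContinuousAt.continuousWithinAt ?_
    have hi := interior_subset hi
    have hj := interior_subset hj
    -- Two primitives differ by a local constant, so the change of labels is locally independent of
    -- x, as continuity into a discrete fibre demands.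
    obtain ⟨c, hc⟩ := hi.sub_eventuallyConst hj
    change Tendsto _ _ _
    rw [nhds_prod_eq, nhds_discrete DiscreteComplex]
    refine tendsto_pure.2 ?_
    have h1 : ∀ᶠ p in 𝓝 x ×ˢ pure v, T.primitive i p.1 = T.primitive j p.1 + c ∧ p.2 = v :=
      hc.prod_mk (show ∀ᶠ w in pure v, w = v from rfl)
    filter_upwards [h1] with p hp
    have h2 := hc.self_of_nhds
    rw [hp.1, hp.2, h2]
    change (show ℂ from v) + _ - _ = (show ℂ from v) + _ - _
    ring

/-- `h` is a primitive of the translation structure along the map `σ`. -/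
def IsPrimitiveAlong (T : TranslationStructure X) {Y : Type*} [TopologicalSpace Y] (σ : Y → X)
    (h : Y → ℂ) : Prop :=
  ∀ y, ∀ F, T.IsPrimitiveAt F (σ y) → ∃ c : ℂ, ∀ᶠ y' in 𝓝 y, h y' = F (σ y') + c

section

variable {Y Z : Type*} [TopologicalSpace Y] [TopologicalSpace Z]

theorem IsPrimitiveAlong.of_exists [T1Space X] {T : TranslationStructure X} {σ : Y → X}
    (hσ : Continuous σ) {h : Y → ℂ}
    (H : ∀ y, ∃ F, T.IsPrimitiveAt F (σ y) ∧ ∃ c : ℂ, ∀ᶠ y' in 𝓝 y, h y' = F (σ y') + c) :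
    T.IsPrimitiveAlong σ h := by
  intro y G hG
  obtain ⟨F, hF, c, hc⟩ := H y
  obtain ⟨d, hd⟩ := hF.sub_eventuallyConst hG
  refine ⟨d + c, ?_⟩
  filter_upwards [hc, hσ.continuousAt.eventually hd] with z h1 h2
  rw [h1, h2]; ring

theorem IsPrimitiveAlong.comp {T : TranslationStructure X} {σ : Y → X} {h : Y → ℂ}
    (H : T.IsPrimitiveAlong σ h) {g : Z → Y} (hg : Continuous g) :
    T.IsPrimitiveAlong (σ ∘ g) (h ∘ g) := by
  intro z F hF
  obtain ⟨c, hc⟩ := H (g z) F hF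
  exact ⟨c, hg.continuousAt.eventually hc⟩

/-- Two primitives along the same map differ by a locally constant function, and Y is preconnected.
This makes holonomy independent of the chosen lift. -/
theorem IsPrimitiveAlong.sub_eq_sub [PreconnectedSpace Y] {T : TranslationStructure X}
    {σ : Y → X} {h h' : Y → ℂ} (H : T.IsPrimitiveAlong σ h) (H' : T.IsPrimitiveAlong σ h')
    (y z : Y) : h y - h z = h' y - h' z := by
  have key : h y - h' y = h z - h' z := by
    refine PreconnectedSpace.induction₂' (fun a b => h a - h' a = h b - h' b) ?_
      ⟨fun _ _ _ h h' => h.trans h'⟩ y z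
    intro a
    obtain ⟨c, hc⟩ := H a _ (T.isPrimitiveAt_primitive (σ a))
    obtain ⟨d, hd⟩ := H' a _ (T.isPrimitiveAt_primitive (σ a))
    filter_upwards [hc, hd] with b h1 h2
    have : h a - h' a = h b - h' b := by
      rw [hc.self_of_nhds, hd.self_of_nhds, h1, h2]; ring
    exact ⟨this, this.symm⟩
  linear_combination key

theorem IsPrimitiveAlong.transport [T1Space X] {T : TranslationStructure X} {A : GL(2, ℝ)⁺}
    {f : X ≃ₜ X} (hf : ∀ φ ∈ T.maximalAtlas, transportChart A f φ ∈ T.maximalAtlas)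
    {σ : Y → X} (hσ : Continuous σ) {h : Y → ℂ} (H : T.IsPrimitiveAlong σ h) :
    T.IsPrimitiveAlong (f ∘ σ) (fun y => planeMap (A : GL (Fin 2) ℝ) (h y)) := by
  refine .of_exists (f.continuous.comp hσ) fun y => ?_
  have hP := T.isPrimitiveAt_primitive (σ y)
  obtain ⟨c, hc⟩ := H y _ hP
  refine ⟨_, hP.transport hf, planeMap (A : GL (Fin 2) ℝ) c, ?_⟩
  filter_upwards [hc] with z hz
  simp [hz, planeMap_add]

/-- Along a map from a contractible space the translation structure has a primitive. -/
theorem exists_isPrimitiveAlong [T1Space X] (T : TranslationStructure X) [ContractibleSpace Y]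
    (σ : C(Y, X)) : ∃ h : Y → ℂ, T.IsPrimitiveAlong σ h := by
  let Z := T.primitiveCore
  have cov : IsCoveringMap (Z.proj) := FiberBundle.isCoveringMap (F := DiscreteComplex) (E := Z.Fiber)
  obtain ⟨y₀, ⟨K⟩⟩ := id_nullhomotopic Y
  let K' := K.symm
  let e₀ : Z.TotalSpace := ⟨σ y₀, (0 : ℂ)⟩
  -- `σ ∘ K'` is a homotopy from a constant map to σ. Its lift starting at the constant map `e₀`
  -- ends, at time 1, in a lift of σ.
  let s : C(Y, Z.TotalSpace) := (cov.liftHomotopy (σ.comp K'.toContinuousMap) (.const Y e₀)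
    (fun a => by simp [K', e₀])).comp ((ContinuousMap.const Y 1).prodMk (.id Y))
  have hs : ∀ y, Z.proj (s y) = σ y := by
    intro y
    have := congr_fun (cov.liftHomotopy_lifts (σ.comp K'.toContinuousMap) (.const Y e₀)
      (fun a => by simp [K', e₀])) (1, y)
    simpa [s, K'] using this
  -- The value at its base point of the germ that `s y` represents.
  refine ⟨fun y => T.primitive (s y).1 (s y).1 + (show ℂ from (s y).2), ?_⟩
  refine .of_exists σ.continuous fun y => ⟨_, T.isPrimitiveAt_primitive (σ y), ?_⟩
  have hcont : ContinuousAt (fun y' => (Z.localTriv (σ y) (s y')).2) y := by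
    refine continuous_snd.continuousAt.comp (ContinuousAt.comp ?_ s.continuous.continuousAt)
    refine (Z.localTriv (σ y)).continuousAt ?_
    change Z.proj (s y) ∈ Z.baseSet (σ y)
    rw [hs]
    exact Z.mem_baseSet_at (σ y)
  change Tendsto _ _ _ at hcont
  rw [nhds_discrete DiscreteComplex, tendsto_pure] at hcont
  refine ⟨(show ℂ from (Z.localTriv (σ y) (s y)).2), ?_⟩
  filter_upwards [hcont] with y' hy'
  rw [← hy']
  change _ = _ + ((show ℂ from (s y').2) + T.primitive (s y').1 (s y').1 -
    T.primitive (σ y) (s y').1)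
  rw [show (s y').1 = σ y' from hs y']
  ring

end

end TranslationStructure

/-! ### Homomorphisms on first homology from complex cocycles -/

section SimplicialCocycle

open CategoryTheory Limits Simplicial

/-- The homomorphism `ℤ → ℂ` with value `z` at `1`, in the universe `u`. -/
noncomputable def intHom (z : ℂ) :
    ModuleCat.of ℤ (ULift.{u} ℤ) ⟶ ModuleCat.of ℤ (ULift.{u} ℂ) :=
  ModuleCat.ofHom ((LinearMap.toSpanSingleton ℤ (ULift.{u} ℂ) ⟨z⟩).comp
    (ULift.moduleEquiv (R := ℤ) (M := ℤ)).toLinearMap)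

theorem intHom_add (z w : ℂ) : intHom.{u} (z + w) = intHom z + intHom w := by
  ext
  simp [intHom, mul_add]

theorem intHom_zero : intHom.{u} 0 = 0 := by
  ext
  simp [intHom]

theorem intHom_neg (z : ℂ) : intHom.{u} (-z) = -intHom z := by
  ext
  simp [intHom]

theorem intHom_apply_one (z : ℂ) : (intHom.{u} z ⟨1⟩).down = z := by
  simp [intHom]

theorem intHom_comp (z : ℂ)
    (A : ModuleCat.of ℤ (ULift.{u} ℂ) ⟶ ModuleCat.of ℤ (ULift.{u} ℂ)) :
    intHom.{u} z ≫ A = intHom (A ⟨z⟩).down := by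
  ext n
  change (A.hom (n.down • ⟨z⟩)).down = (n.down • A.hom ⟨z⟩).down
  rw [map_zsmul]

namespace SSet

variable (S : SSet.{u})

/-- The complex valued `1`-cochain with given values on the `1`-simplices. -/
noncomputable def cochainHom (c : S _⦋1⦌ → ℂ) :
    (S.chainComplex (ModuleCat.of ℤ (ULift.{u} ℤ))).X 1 ⟶ ModuleCat.of ℤ (ULift.{u} ℂ) :=
  Sigma.desc fun x => intHom (c x)

theorem ι_cochainHom (c : S _⦋1⦌ → ℂ) (x : S _⦋1⦌) :
    S.ιChainComplex x ≫ S.cochainHom c = intHom (c x) :=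
  Sigma.ι_desc _ _

theorem d_cochainHom (c : S _⦋1⦌ → ℂ)
    (hc : ∀ x : S _⦋2⦌, c (S.δ 0 x) - c (S.δ 1 x) + c (S.δ 2 x) = 0) :
    (S.chainComplex (ModuleCat.of ℤ (ULift.{u} ℤ))).d 2 1 ≫ S.cochainHom c = 0 := by
  refine chainComplex_hom_ext fun x => ?_
  rw [ιChainComplex_d_assoc, Preadditive.sum_comp, comp_zero, Fin.sum_univ_three]
  simp only [Preadditive.zsmul_comp, ι_cochainHom]
  rw [← intHom_zero, ← hc x, sub_eq_add_neg, intHom_add, intHom_add, intHom_neg]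
  simp

/-- The homomorphism on first homology given by a complex valued `1`-cocycle. -/
noncomputable def cocycleHom (c : S _⦋1⦌ → ℂ)
    (hc : ∀ x : S _⦋2⦌, c (S.δ 0 x) - c (S.δ 1 x) + c (S.δ 2 x) = 0) :
    S.homology (ModuleCat.of ℤ (ULift.{u} ℤ)) 1 ⟶ ModuleCat.of ℤ (ULift.{u} ℂ) :=
  -- Homology embeds in chains modulo boundaries, to which a cochain vanishing on boundaries
  -- descends.
  (S.chainComplex _).homologyι 1 ≫
    (S.chainComplex _).descOpcycles (S.cochainHom c) 2 (by simp) (S.d_cochainHom c hc)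

/-- Equality of the cochains on each 1-simplex suffices, since chains modulo boundaries are a
quotient of chains. It is applied to an affine homeomorphism, with its derivative as the map on
coefficients. -/
theorem homologyMap_cocycleHom {S S' : SSet.{u}} (φ : S ⟶ S') (c : S _⦋1⦌ → ℂ) (c' : S' _⦋1⦌ → ℂ)
    (hc : ∀ x : S _⦋2⦌, c (S.δ 0 x) - c (S.δ 1 x) + c (S.δ 2 x) = 0)
    (hc' : ∀ x : S' _⦋2⦌, c' (S'.δ 0 x) - c' (S'.δ 1 x) + c' (S'.δ 2 x) = 0)
    (A : ModuleCat.of ℤ (ULift.{u} ℂ) ⟶ ModuleCat.of ℤ (ULift.{u} ℂ))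
    (hA : ∀ x, (c' (φ.app _ x)) = (A ⟨c x⟩).down) :
    SSet.homologyMap φ _ 1 ≫ S'.cocycleHom c' hc' = S.cocycleHom c hc ≫ A := by
  simp only [cocycleHom, Category.assoc]
  rw [HomologicalComplex.homologyι_naturality_assoc]
  congr 1
  rw [← cancel_epi (HomologicalComplex.pOpcycles _ _)]
  rw [HomologicalComplex.p_opcyclesMap_assoc, HomologicalComplex.p_descOpcycles,
    HomologicalComplex.p_descOpcycles_assoc]
  refine chainComplex_hom_ext fun x => ?_
  rw [ι_chainComplexMap_f_assoc, ι_cochainHom, ← Category.assoc, ι_cochainHom, hA, intHom_comp]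

/-- The value of a cocycle on a triangular cycle. -/
theorem exists_cocycleHom_eq (c : S _⦋1⦌ → ℂ)
    (hc : ∀ x : S _⦋2⦌, c (S.δ 0 x) - c (S.δ 1 x) + c (S.δ 2 x) = 0) (a b s : S _⦋1⦌)
    (h₁ : S.δ 1 a = S.δ 1 b) (h₂ : S.δ 0 a = S.δ 1 s) (h₃ : S.δ 0 s = S.δ 0 b) :
    ∃ x, (S.cocycleHom c hc x).down = c a + c s - c b := by
  let z : ModuleCat.of ℤ (ULift.{u} ℤ) ⟶ (S.chainComplex (ModuleCat.of ℤ (ULift.{u} ℤ))).X 1 :=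
    S.ιChainComplex a + S.ιChainComplex s - S.ιChainComplex b
  have hz : z ≫ (S.chainComplex (ModuleCat.of ℤ (ULift.{u} ℤ))).d 1 0 = 0 := by
    have hd : ∀ x : S _⦋1⦌, S.ιChainComplex x ≫
        (S.chainComplex (ModuleCat.of ℤ (ULift.{u} ℤ))).d 1 0 =
        S.ιChainComplex (S.δ 0 x) - S.ιChainComplex (S.δ 1 x) := by
      intro x
      refine (S.ιChainComplex_d _ (n := 0) x).trans ?_
      rw [Fin.sum_univ_two]
      simp [sub_eq_add_neg]
    simp only [z, Preadditive.add_comp, Preadditive.sub_comp, hd, h₁, h₂, h₃]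
    abel
  have key : (S.chainComplex (ModuleCat.of ℤ (ULift.{u} ℤ))).liftCycles z 0 (by simp) hz ≫
      (S.chainComplex _).homologyπ 1 ≫ S.cocycleHom c hc = intHom (c a + c s - c b) := by
    rw [cocycleHom, HomologicalComplex.homology_π_ι_assoc, HomologicalComplex.liftCycles_i_assoc,
      HomologicalComplex.p_descOpcycles]
    simp only [z, Preadditive.add_comp, Preadditive.sub_comp, ι_cochainHom]
    rw [sub_eq_add_neg (c a + c s), intHom_add, intHom_add, intHom_neg, sub_eq_add_neg]
  refine ⟨(S.chainComplex (ModuleCat.of ℤ (ULift.{u} ℤ))).homologyπ 1 |>.hom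
    ((S.chainComplex (ModuleCat.of ℤ (ULift.{u} ℤ))).liftCycles z 0 (by simp) hz |>.hom ⟨1⟩), ?_⟩
  rw [← intHom_apply_one.{u} (c a + c s - c b), ← key]
  rfl

end SSet

end SimplicialCocycle

/-! ### Holonomy of singular simplices and the period homomorphism -/

namespace TranslationStructure

open CategoryTheory Simplicial SimplexCategory

variable {X : Type u} [TopologicalSpace X]

instance (n : SimplexCategory) : ContractibleSpace (toTop.{u}.obj n) :=
  have : ContractibleSpace (stdSimplex ℝ (Fin (n.len + 1))) :=
    (convex_stdSimplex ℝ _).contractibleSpace ⟨_, single_mem_stdSimplex ℝ 0⟩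
  (Homeomorph.ulift (X := stdSimplex ℝ (Fin (n.len + 1)))).contractibleSpace

/-- The vertices of the topological simplex. -/
noncomputable def topVertex (n : ℕ) (i : Fin (n + 1)) : toTop.{u}.obj ⦋n⦌ := ⟨stdSimplex.vertex i⟩

theorem map_topVertex {m n : ℕ} (f : ⦋m⦌ ⟶ ⦋n⦌) (i : Fin (m + 1)) :
    toTop.{u}.map f (topVertex m i) = topVertex n (f i) := by
  apply ULift.ext
  exact stdSimplex.map_vertex _ _

/-- The continuous map underlying a singular simplex. -/
noncomputable def simplexMap {n : ℕ} (x : (TopCat.toSSet.obj (TopCat.of X)) _⦋n⦌) :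
    C(toTop.{u}.obj ⦋n⦌, X) := x.down.hom

/-- The difference of the end values of a primitive along a singular `1`-simplex. -/
noncomputable def holonomy [T1Space X] (T : TranslationStructure X)
    (x : (TopCat.toSSet.obj (TopCat.of X)) _⦋1⦌) : ℂ :=
  (T.exists_isPrimitiveAlong (simplexMap x)).choose (topVertex 1 1) -
    (T.exists_isPrimitiveAlong (simplexMap x)).choose (topVertex 1 0)

theorem holonomy_eq [T1Space X] (T : TranslationStructure X)
    (x : (TopCat.toSSet.obj (TopCat.of X)) _⦋1⦌) {h : toTop.{u}.obj ⦋1⦌ → ℂ}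
    (hh : T.IsPrimitiveAlong (simplexMap x) h) :
    T.holonomy x = h (topVertex 1 1) - h (topVertex 1 0) :=
  (T.exists_isPrimitiveAlong (simplexMap x)).choose_spec.sub_eq_sub hh _ _

theorem simplexMap_δ {n : ℕ} (x : (TopCat.toSSet.obj (TopCat.of X)) _⦋n + 1⦌) (i : Fin (n + 2)) :
    ⇑(simplexMap ((TopCat.toSSet.obj (TopCat.of X)).δ i x)) =
      simplexMap x ∘ toTop.{u}.map (SimplexCategory.δ i) :=
  rfl

/-- One primitive h along the whole 2-simplex restricts to primitives along its faces, so the sum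
telescopes in the values of h at the three vertices. -/
theorem holonomy_cocycle [T1Space X] (T : TranslationStructure X)
    (x : (TopCat.toSSet.obj (TopCat.of X)) _⦋2⦌) :
    T.holonomy ((TopCat.toSSet.obj (TopCat.of X)).δ 0 x) -
      T.holonomy ((TopCat.toSSet.obj (TopCat.of X)).δ 1 x) +
      T.holonomy ((TopCat.toSSet.obj (TopCat.of X)).δ 2 x) = 0 := by
  obtain ⟨h, hh⟩ := T.exists_isPrimitiveAlong (simplexMap x)
  have key : ∀ i : Fin 3, T.holonomy ((TopCat.toSSet.obj (TopCat.of X)).δ i x) =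
      h (topVertex 2 (i.succAbove 1)) - h (topVertex 2 (i.succAbove 0)) := by
    intro i
    rw [T.holonomy_eq _ (h := h ∘ toTop.{u}.map (SimplexCategory.δ i))]
    · simp only [Function.comp_apply, map_topVertex]
      rfl
    · rw [simplexMap_δ]
      exact hh.comp (toTop.{u}.map (SimplexCategory.δ i)).hom.continuous
  rw [key, key, key]
  have h0 : ((0 : Fin 3).succAbove 1, (0 : Fin 3).succAbove 0, (1 : Fin 3).succAbove 1,
    (1 : Fin 3).succAbove 0, (2 : Fin 3).succAbove 1, (2 : Fin 3).succAbove 0) =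
    ((2 : Fin 3), (1 : Fin 3), (2 : Fin 3), (0 : Fin 3), (1 : Fin 3), (0 : Fin 3)) := by decide
  simp only [Prod.mk.injEq] at h0
  obtain ⟨h1, h2, h3, h4, h5, h6⟩ := h0
  rw [h1, h2, h3, h4, h5, h6]
  ring

/-- The period homomorphism on first homology. -/
noncomputable def period [T1Space X] (T : TranslationStructure X) : singularH1 X →ₗ[ℤ] ℂ :=
  (ULift.moduleEquiv (R := ℤ) (M := ℂ)).toLinearMap.comp
    ((TopCat.toSSet.obj (TopCat.of X)).cocycleHom T.holonomy T.holonomy_cocycle).hom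

/-- The linear action on the plane as an endomorphism of the lifted additive group of `ℂ`. -/
noncomputable def planeHom (A : Matrix (Fin 2) (Fin 2) ℝ) :
    ModuleCat.of ℤ (ULift.{u} ℂ) ⟶ ModuleCat.of ℤ (ULift.{u} ℂ) :=
  ModuleCat.ofHom (AddMonoidHom.toIntLinearMap
    { toFun := fun z => ⟨planeMap A z.down⟩
      map_zero' := by
        apply ULift.ext; apply Complex.ext <;> simp [planeMap]
      map_add' := fun z w => by
        apply ULift.ext; exact planeMap_add A _ _ })

/-- The periods are stable under the Veech group. -/
theorem planeMap_mem_range_period [T1Space X] (T : TranslationStructure X) {A : GL(2, ℝ)⁺}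
    (hA : A ∈ T.veechGroup) {z : ℂ} (hz : z ∈ LinearMap.range T.period) :
    planeMap (A : GL (Fin 2) ℝ) z ∈ LinearMap.range T.period := by
  obtain ⟨f, hf⟩ := hA
  obtain ⟨x, rfl⟩ := hz
  have key := SSet.homologyMap_cocycleHom (TopCat.toSSet.map (TopCat.ofHom (f : C(X, X))))
    T.holonomy T.holonomy T.holonomy_cocycle T.holonomy_cocycle
    (planeHom (A : GL (Fin 2) ℝ)) (by
      intro x
      obtain ⟨h, hh⟩ := T.exists_isPrimitiveAlong (simplexMap x)
      -- If h is a primitive along a simplex, then `A ∘ h` is one along its image under f, so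
      -- holonomy is multiplied by A.
      have h1 := hh.transport (fun φ => (hf φ).2) (simplexMap x).continuous
      rw [T.holonomy_eq x hh]
      refine (T.holonomy_eq ((TopCat.toSSet.map (TopCat.ofHom (f : C(X, X)))).app _ x)
        (h := fun y => planeMap (A : GL (Fin 2) ℝ) (h y)) h1).trans ?_
      change _ = planeMap _ (_ - _)
      rw [sub_eq_iff_eq_add, ← planeMap_add]
      simp)
  refine ⟨(SSet.homologyMap (TopCat.toSSet.map (TopCat.ofHom (f : C(X, X))))
    (ModuleCat.of ℤ (ULift.{u} ℤ)) 1).hom x, ?_⟩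
  exact congrArg ULift.down (ConcreteCategory.congr_hom key x)

/-- The singular `1`-simplex given by a path. -/
noncomputable def pathSimplex {x y : X} (γ : Path x y) : (TopCat.toSSet.obj (TopCat.of X)) _⦋1⦌ :=
  ⟨TopCat.ofHom (γ.toContinuousMap.comp
    ((stdSimplexHomeomorphUnitInterval : C(stdSimplex ℝ (Fin 2), unitInterval)).comp
      ⟨ULift.down, continuous_uliftDown⟩))⟩

theorem simplexMap_pathSimplex {x y : X} (γ : Path x y) :
    ⇑(simplexMap (pathSimplex γ)) = γ ∘ stdSimplexHomeomorphUnitInterval ∘ ULift.down :=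
  rfl

theorem simplexMap_pathSimplex_zero {x y : X} (γ : Path x y) :
    simplexMap (pathSimplex γ) (topVertex 1 0) = x := by
  rw [simplexMap_pathSimplex]
  refine Eq.trans ?_ γ.source
  exact congrArg γ stdSimplexHomeomorphUnitInterval_zero

theorem simplexMap_pathSimplex_one {x y : X} (γ : Path x y) :
    simplexMap (pathSimplex γ) (topVertex 1 1) = y := by
  rw [simplexMap_pathSimplex]
  refine Eq.trans ?_ γ.target
  exact congrArg γ stdSimplexHomeomorphUnitInterval_one

theorem zeroSimplex_ext {a b : (TopCat.toSSet.obj (TopCat.of X)) _⦋0⦌}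
    (h : simplexMap a (topVertex 0 0) = simplexMap b (topVertex 0 0)) : a = b := by
  apply ULift.ext
  apply TopCat.hom_ext
  ext t
  obtain rfl : t = topVertex 0 0 := Subsingleton.elim (α := toTop.{u}.obj ⦋0⦌) t _
  exact h

theorem simplexMap_δ_zero {x y : X} (γ : Path x y) :
    simplexMap ((TopCat.toSSet.obj (TopCat.of X)).δ 0 (pathSimplex γ)) (topVertex 0 0) = y := by
  rw [simplexMap_δ, Function.comp_apply, map_topVertex]
  exact simplexMap_pathSimplex_one γ

theorem simplexMap_δ_one {x y : X} (γ : Path x y) :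
    simplexMap ((TopCat.toSSet.obj (TopCat.of X)).δ 1 (pathSimplex γ)) (topVertex 0 0) = x := by
  rw [simplexMap_δ, Function.comp_apply, map_topVertex]
  exact simplexMap_pathSimplex_zero γ

/-- The three paths bound a closed triangle, hence a 1-cycle; no null-homotopy is required. -/
theorem exists_period_eq [T1Space X] (T : TranslationStructure X) {x y z : X} (γ : Path x y)
    (s : Path y z) (γ' : Path x z) : ∃ a, T.period a =
      T.holonomy (pathSimplex γ) + T.holonomy (pathSimplex s) - T.holonomy (pathSimplex γ') :=
  (TopCat.toSSet.obj (TopCat.of X)).exists_cocycleHom_eq T.holonomy T.holonomy_cocycle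
    (pathSimplex γ) (pathSimplex γ') (pathSimplex s)
    (zeroSimplex_ext (by rw [simplexMap_δ_one, simplexMap_δ_one]))
    (zeroSimplex_ext (by rw [simplexMap_δ_zero, simplexMap_δ_one]))
    (zeroSimplex_ext (by rw [simplexMap_δ_zero, simplexMap_δ_zero]))

/-! ### Periods span the plane over the reals -/

theorem locallyPathConnectedSpace (T : TranslationStructure X) : LocallyPathConnectedSpace X := by
  choose ψ hψ using T.exists_chart
  let _ : ChartedSpace ℂ X :=
    { atlas := univ
      chartAt := ψ
      mem_chart_source := hψ
      chart_mem_atlas := fun _ => mem_univ _ }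
  exact ChartedSpace.locallyPathConnectedSpace ℂ X

/-- If a real linear functional kills all periods, then it has a global primitive. -/
theorem exists_global_primitive [T1Space X] [ConnectedSpace X] (T : TranslationStructure X)
    (ℓ : ℂ →ₗ[ℝ] ℝ) (h : ∀ a, ℓ (T.period a) = 0) :
    ∃ g : X → ℝ, ∀ x, ∀ F, T.IsPrimitiveAt F x → ∀ᶠ y in 𝓝 x, g y - g x = ℓ (F y - F x) := by
  have := T.locallyPathConnectedSpace
  have hpc : PathConnectedSpace X := pathConnectedSpace_iff_connectedSpace.2 inferInstance
  obtain ⟨x₀⟩ := hpc.nonempty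
  let γ : ∀ x, Path x₀ x := fun x => PathConnectedSpace.somePath x₀ x
  -- The paths `γ x` may be chosen arbitrarily: changing the path alters the holonomy by a period,
  -- which ℓ kills.
  refine ⟨fun x => ℓ (T.holonomy (pathSimplex (γ x))), fun x F hF => ?_⟩
  obtain ⟨V, ⟨hV, hVp⟩, hVs⟩ := (path_connected_basis x).mem_iff.1 hF.eventually
  filter_upwards [hV] with y hy
  obtain ⟨s, hs⟩ := hVp.joinedIn x (mem_of_mem_nhds hV) y hy
  obtain ⟨a, ha⟩ := T.exists_period_eq (γ x) s (γ y)
  have h1 : T.holonomy (pathSimplex s) = F y - F x := by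
    rw [T.holonomy_eq (h := F ∘ simplexMap (pathSimplex s)), Function.comp_apply,
      Function.comp_apply, simplexMap_pathSimplex_zero, simplexMap_pathSimplex_one]
    refine .of_exists (simplexMap (pathSimplex s)).continuous fun t => ⟨F, ?_, 0, by simp⟩
    exact hVs (hs _)
  have h2 := h a
  rw [ha, h1] at h2
  simp only [map_sub, map_add] at h2 ⊢
  linarith

/-- The periods are not contained in a real line. -/
theorem exists_period_ne_zero [T1Space X] [CompactSpace X] [ConnectedSpace X]
    (T : TranslationStructure X) (ℓ : ℂ →ₗ[ℝ] ℝ) (hℓ : ℓ ≠ 0) : ∃ a, ℓ (T.period a) ≠ 0 := by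
  by_contra! h
  obtain ⟨g, hg⟩ := T.exists_global_primitive ℓ h
  have hcℓ : Continuous ℓ := ℓ.continuous_of_finiteDimensional
  have hcont : Continuous g := by
    rw [continuous_iff_continuousAt]
    intro x
    have h1 := hg x _ (T.isPrimitiveAt_primitive x)
    have h2 : ContinuousAt (fun y => ℓ (T.primitive x y - T.primitive x x) + g x) x :=
      (hcℓ.continuousAt.comp ((T.isPrimitiveAt_primitive x).1.sub_const _)).add_const _
    refine h2.congr ?_
    filter_upwards [h1] with y hy
    rw [← hy]; ring
  -- At a maximum x of g, ℓ of the increment of the primitive is nonpositive nearby. But the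
  -- primitive is open at x, so its increments include small positive multiples of a vector on which
  -- ℓ is positive.
  obtain ⟨x, -, hx⟩ := isCompact_univ.exists_isMaxOn univ_nonempty hcont.continuousOn
  have h1 : ∀ᶠ y in 𝓝 x, ℓ (T.primitive x y - T.primitive x x) ≤ 0 := by
    filter_upwards [hg x _ (T.isPrimitiveAt_primitive x)] with y hy
    rw [← hy]
    have : g y ≤ g x := hx (mem_univ y)
    linarith
  have h2 : ∀ᶠ w in 𝓝 (T.primitive x x), ℓ (w - T.primitive x x) ≤ 0 :=
    T.nhds_le_map_primitive x h1
  obtain ⟨v, hv⟩ : ∃ v, 0 < ℓ v := by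
    obtain ⟨v, hv⟩ : ∃ v, ℓ v ≠ 0 := by
      by_contra! h0
      exact hℓ (LinearMap.ext h0)
    rcases hv.lt_or_gt with h0 | h0
    · exact ⟨-v, by simpa using h0⟩
    · exact ⟨v, h0⟩
  have h3 : Tendsto (fun t : ℝ => T.primitive x x + t • v) (𝓝[>] 0) (𝓝 (T.primitive x x)) := by
    refine tendsto_nhdsWithin_of_tendsto_nhds ?_
    have : Continuous (fun t : ℝ => T.primitive x x + t • v) := by fun_prop
    simpa using this.tendsto 0
  obtain ⟨t, ht, ht0⟩ := ((h3.eventually h2).and self_mem_nhdsWithin).exists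
  rw [add_sub_cancel_left, map_smul, smul_eq_mul] at ht
  exact absurd ht (not_le.2 (mul_pos ht0 hv))

end TranslationStructure

/-! ### Area, and determinant one for the Veech group -/

namespace TranslationStructure

open MeasureTheory

variable {X : Type u} [TopologicalSpace X]

/-- The linear action of a matrix on the plane, as a real linear map. -/
noncomputable def planeLinearMap (A : Matrix (Fin 2) (Fin 2) ℝ) : ℂ →ₗ[ℝ] ℂ where
  toFun := planeMap A
  map_add' := planeMap_add A
  map_smul' t z := by apply Complex.ext <;> simp [planeMap] <;> ring

theorem det_planeLinearMap (A : Matrix (Fin 2) (Fin 2) ℝ) :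
    LinearMap.det (planeLinearMap A) = A.det := by
  rw [← LinearMap.det_toMatrix Complex.basisOneI]
  congr 1
  ext i j
  fin_cases i <;> fin_cases j <;> simp [LinearMap.toMatrix_apply, planeLinearMap, planeMap]

theorem det_inv_mul_det (A : GL(2, ℝ)⁺) :
    (((A⁻¹ : GL(2, ℝ)⁺) : GL (Fin 2) ℝ) : Matrix (Fin 2) (Fin 2) ℝ).det *
      (A : GL (Fin 2) ℝ).val.det = 1 := by
  rw [← Matrix.det_mul, ← Units.val_mul, ← Subgroup.coe_mul, inv_mul_cancel]
  simp

theorem volume_transportChart_target (A : GL(2, ℝ)⁺) (f : X ≃ₜ X) (φ : OpenPartialHomeomorph X ℂ) :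
    volume (transportChart A f φ).target =
      ENNReal.ofReal (A : GL (Fin 2) ℝ).val.det * volume φ.target := by
  have h : (transportChart A f φ).target =
      planeLinearMap ((A⁻¹ : GL(2, ℝ)⁺) : GL (Fin 2) ℝ) ⁻¹' φ.target := by
    rfl
  have hpos : 0 < (A : GL (Fin 2) ℝ).val.det := A.2
  have hdet : (((A⁻¹ : GL(2, ℝ)⁺) : GL (Fin 2) ℝ) : Matrix (Fin 2) (Fin 2) ℝ).det =
      ((A : GL (Fin 2) ℝ).val.det)⁻¹ := eq_inv_of_mul_eq_one_left (det_inv_mul_det A)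
  rw [h, Measure.addHaar_preimage_linearMap, det_planeLinearMap, hdet, inv_inv, abs_of_pos hpos]
  rw [det_planeLinearMap, hdet]
  exact inv_ne_zero hpos.ne'

/-- The total areas of the finite families of disjoint charts of the maximal atlas. -/
def areaSums (T : TranslationStructure X) : Set ENNReal :=
  {a | ∃ (n : ℕ) (φ : Fin n → OpenPartialHomeomorph X ℂ), (∀ i, φ i ∈ T.maximalAtlas) ∧
    Pairwise (fun i j => Disjoint (φ i).source (φ j).source) ∧ a = ∑ i, volume (φ i).target}

/-- The area of a translation surface. -/
noncomputable def area (T : TranslationStructure X) : ENNReal := sSup T.areaSums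

theorem exists_chart_pow (T : TranslationStructure X) (x : X) :
    ∃ (ψ : OpenPartialHomeomorph X ℂ) (k : ℕ), x ∈ ψ.source ∧
      ∀ e ∈ T.atlas, ∀ y ∈ ψ.source ∩ e.source, ∃ c : ℂ, ∀ᶠ z in 𝓝 y, e z = ψ z ^ k + c := by
  by_cases hx : x ∈ T.sing
  · obtain ⟨ψ, k, -, h1, -, h2⟩ := T.conical x hx
    exact ⟨ψ, k, h1, h2⟩
  · obtain ⟨e, he, h⟩ := T.cover x hx
    refine ⟨e, 1, h, fun e' he' y hy => ?_⟩
    simpa using T.translation e he e' he' y hy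

/-- Off the singular set, `φ ∘ ψ.symm` is locally `z ^ k` plus a constant, so its Jacobian is at
most C on B. The singular points that φ may contain (removable ones) have a finite image, of measure
zero. -/
theorem volume_image_le [T1Space X] (T : TranslationStructure X) {ψ : OpenPartialHomeomorph X ℂ} {k : ℕ}
    (hψ : ∀ e ∈ T.atlas, ∀ y ∈ ψ.source ∩ e.source, ∃ c : ℂ, ∀ᶠ z in 𝓝 y, e z = ψ z ^ k + c)
    {C : ℝ} {B : Set ℂ}
    (hC : ∀ z ∈ B, |(fderiv ℝ (fun w : ℂ => w ^ k) z).det| ≤ C) {φ : OpenPartialHomeomorph X ℂ}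
    (hφ : φ ∈ T.maximalAtlas) {U : Set X} (hUo : IsOpen U) (hU : U ⊆ ψ.source ∩ ψ ⁻¹' B) :
    volume (φ '' (φ.source ∩ U)) ≤ ENNReal.ofReal C * volume (ψ '' (φ.source ∩ U)) := by
  set W := (φ.source ∩ U) \ T.sing with hW
  have hWo : IsOpen W := (φ.open_source.inter hUo).sdiff T.finite_sing.isClosed
  have hWψ : W ⊆ ψ.source := fun y hy => (hU hy.1.2).1
  have hsub : φ '' (φ.source ∩ U) ⊆ (φ ∘ ψ.symm) '' (ψ '' W) ∪ φ '' T.sing := by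
    rintro _ ⟨y, hy, rfl⟩
    by_cases hys : y ∈ T.sing
    · exact .inr ⟨y, hys, rfl⟩
    · refine .inl ⟨ψ y, ⟨y, ⟨hy, hys⟩, rfl⟩, ?_⟩
      simp [ψ.left_inv (hU hy.2).1]
  have hmeas : MeasurableSet (ψ '' W) := (ψ.isOpen_image_of_subset_source hWo hWψ).measurableSet
  have hderiv : ∀ z ∈ ψ '' W, HasFDerivWithinAt (φ ∘ ψ.symm)
      (fderiv ℝ (fun w : ℂ => w ^ k) z) (ψ '' W) z := by
    rintro _ ⟨y, hy, rfl⟩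
    obtain ⟨e, he, hye⟩ := T.cover y hy.2
    obtain ⟨c, hc⟩ := hφ e he y ⟨hy.1.1, hye⟩
    obtain ⟨d, hd⟩ := hψ e he y ⟨hWψ hy, hye⟩
    have hd' : DifferentiableAt ℝ (fun w : ℂ => w ^ k) (ψ y) := by fun_prop
    refine HasFDerivAt.hasFDerivWithinAt ?_
    refine (hd'.hasFDerivAt.add_const (d + c)).congr_of_eventuallyEq ?_
    have ht := ψ.map_source (hWψ hy)
    have hcont : Tendsto ψ.symm (𝓝 (ψ y)) (𝓝 y) := by
      simpa [ContinuousAt, ψ.left_inv (hWψ hy)] using ψ.continuousAt_symm ht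
    filter_upwards [hcont.eventually hc, hcont.eventually hd, ψ.open_target.mem_nhds ht]
      with w h1 h2 h3
    rw [Function.comp_apply, h1, h2, ψ.right_inv h3, add_assoc]
  calc volume (φ '' (φ.source ∩ U))
      ≤ volume ((φ ∘ ψ.symm) '' (ψ '' W)) + volume (φ '' T.sing) :=
        (measure_mono hsub).trans (measure_union_le _ _)
    _ = volume ((φ ∘ ψ.symm) '' (ψ '' W)) := by
        rw [(T.finite_sing.image φ).measure_zero, add_zero]
    _ ≤ ∫⁻ z in ψ '' W, ENNReal.ofReal |(fderiv ℝ (fun w : ℂ => w ^ k) z).det| :=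
        addHaar_image_le_lintegral_abs_det_fderiv volume hmeas hderiv
    _ ≤ ∫⁻ _ in ψ '' W, ENNReal.ofReal C := by
        refine setLIntegral_mono' hmeas ?_
        rintro _ ⟨y, hy, rfl⟩
        exact ENNReal.ofReal_le_ofReal (hC _ (hU hy.1.2).2)
    _ = ENNReal.ofReal C * volume (ψ '' W) := setLIntegral_const _ _
    _ ≤ ENNReal.ofReal C * volume (ψ '' (φ.source ∩ U)) := by
        gcongr
        exact sdiff_subset

/-- By compactness a bound near each point suffices. There, area is at most a constant times area in
the single chart ψ, where the disjoint sources have disjoint images inside one ball. The bound does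
not depend on the family. -/
theorem area_lt_top [T1Space X] [CompactSpace X] (T : TranslationStructure X) : T.area < ⊤ := by
  have key : ∃ C < (⊤ : ENNReal), ∀ (n : ℕ) (φ : Fin n → OpenPartialHomeomorph X ℂ),
      (∀ i, φ i ∈ T.maximalAtlas) →
      Pairwise (fun i j => Disjoint (φ i).source (φ j).source) →
      ∑ i, volume (φ i '' ((φ i).source ∩ univ)) ≤ C := by
    refine isCompact_univ.induction_on (p := fun s : Set X => ∃ C < (⊤ : ENNReal),
      ∀ (n : ℕ) (φ : Fin n → OpenPartialHomeomorph X ℂ), (∀ i, φ i ∈ T.maximalAtlas) →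
      Pairwise (fun i j => Disjoint (φ i).source (φ j).source) →
      ∑ i, volume (φ i '' ((φ i).source ∩ s)) ≤ C) ⟨0, by simp, by simp⟩ ?_ ?_ ?_
    · rintro s t hst ⟨C, hC, h⟩
      refine ⟨C, hC, fun n φ h1 h2 => le_trans (Finset.sum_le_sum fun i _ => ?_) (h n φ h1 h2)⟩
      gcongr
    · rintro s t ⟨C, hC, h⟩ ⟨D, hD, h'⟩
      refine ⟨C + D, ENNReal.add_lt_top.2 ⟨hC, hD⟩, fun n φ h1 h2 => ?_⟩
      refine le_trans ?_ (add_le_add (h n φ h1 h2) (h' n φ h1 h2))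
      rw [← Finset.sum_add_distrib]
      refine Finset.sum_le_sum fun i _ => ?_
      rw [inter_union_distrib_left, image_union]
      exact measure_union_le _ _
    · intro x _
      obtain ⟨ψ, k, hx, hψ⟩ := T.exists_chart_pow x
      have hcd : ContDiff ℝ 1 (fun w : ℂ => w ^ k) := by fun_prop
      obtain ⟨C, hC⟩ := (isCompact_closedBall (ψ x) 1).bddAbove_image
        (f := fun z => |(fderiv ℝ (fun w : ℂ => w ^ k) z).det|) (by
          refine Continuous.continuousOn (continuous_abs.comp ?_)
          exact ContinuousLinearMap.continuous_det.comp (hcd.continuous_fderiv (by simp)))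
      let U := ψ.source ∩ ψ ⁻¹' Metric.ball (ψ x) 1
      have hUo : IsOpen U := ψ.isOpen_inter_preimage Metric.isOpen_ball
      refine ⟨U, nhdsWithin_le_nhds (hUo.mem_nhds ⟨hx, Metric.mem_ball_self one_pos⟩),
        ENNReal.ofReal C * volume (Metric.ball (ψ x) 1),
        ENNReal.mul_lt_top ENNReal.ofReal_lt_top measure_ball_lt_top, fun n φ h1 h2 => ?_⟩
      have h3 : ∀ i, volume (φ i '' ((φ i).source ∩ U)) ≤
          ENNReal.ofReal C * volume (ψ '' ((φ i).source ∩ U)) := fun i =>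
        T.volume_image_le hψ (B := Metric.ball (ψ x) 1)
          (fun z hz => hC ⟨z, Metric.ball_subset_closedBall hz, rfl⟩) (h1 i) hUo Subset.rfl
      refine (Finset.sum_le_sum fun i _ => h3 i).trans ?_
      rw [← Finset.mul_sum]
      gcongr
      rw [← tsum_fintype (L := .unconditional _), ← measure_iUnion]
      · refine measure_mono (iUnion_subset fun i => ?_)
        rintro _ ⟨y, hy, rfl⟩
        exact hy.2.2
      · intro i j hij
        rw [Function.onFun, Set.disjoint_left]
        rintro _ ⟨y, hy, rfl⟩ ⟨y', hy', h⟩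
        rw [ψ.injOn hy'.2.1 hy.2.1 h] at hy'
        exact Set.disjoint_left.1 (h2 hij) hy.1 hy'.1
      · intro i
        exact (ψ.isOpen_image_of_subset_source ((φ i).open_source.inter hUo)
          fun y hy => hy.2.1).measurableSet
  obtain ⟨C, hC, h⟩ := key
  refine lt_of_le_of_lt (sSup_le ?_) hC
  rintro _ ⟨n, φ, h1, h2, rfl⟩
  simpa [OpenPartialHomeomorph.image_source_eq_target] using h n φ h1 h2

theorem area_pos [T1Space X] [Nonempty X] (T : TranslationStructure X) : 0 < T.area := by
  obtain ⟨x⟩ := ‹Nonempty X›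
  obtain ⟨V, hVs, hVo, hxV, hVp, ⟨y, hy⟩, hcl⟩ :=
    T.exists_isPreconnected_punctured (eventually_nhdsWithin_iff.1 (T.eventually_notMem_sing x))
  obtain ⟨e, he, hye⟩ := T.cover y (hVs hy.1 hy.2)
  have h1 : 0 < volume e.target := e.open_target.measure_pos _ ⟨_, e.map_source hye⟩
  refine h1.trans_le (le_sSup ⟨1, fun _ => e, fun _ => T.atlas_subset_maximalAtlas he, ?_, by simp⟩)
  intro i j hij
  exact absurd (Subsingleton.elim i j) hij

/-- Transport by f sends disjoint families in the maximal atlas to such families and multiplies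
their area by `det A`. Hence `det A * area ≤ area`, and an area that is positive and finite cancels.
-/
theorem det_le_one [T1Space X] [CompactSpace X] [Nonempty X] (T : TranslationStructure X)
    {A : GL(2, ℝ)⁺} (hA : A ∈ T.veechGroup) : (A : GL (Fin 2) ℝ).val.det ≤ 1 := by
  obtain ⟨f, hf⟩ := hA
  have h1 : ENNReal.ofReal (A : GL (Fin 2) ℝ).val.det * T.area ≤ T.area := by
    conv_lhs => rw [area, ENNReal.mul_sSup]
    refine iSup₂_le ?_
    rintro _ ⟨n, φ, h1, h2, rfl⟩
    refine le_sSup ⟨n, fun i => transportChart A f (φ i), fun i => (hf _).2 (h1 i), ?_, ?_⟩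
    · intro i j hij
      exact (h2 hij).preimage f.symm
    · simp only [volume_transportChart_target, Finset.mul_sum]
  have h2 : ENNReal.ofReal (A : GL (Fin 2) ℝ).val.det ≤ 1 :=
    (ENNReal.mul_le_mul_iff_left T.area_pos.ne' T.area_lt_top.ne).1 (by rwa [one_mul])
  simpa using h2

theorem det_eq_one [T1Space X] [CompactSpace X] [Nonempty X] (T : TranslationStructure X)
    {A : GL(2, ℝ)⁺} (hA : A ∈ T.veechGroup) : (A : GL (Fin 2) ℝ).val.det = 1 := by
  refine le_antisymm (T.det_le_one hA) ?_
  have h1 := T.det_le_one (T.veechGroup.inv_mem hA)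
  have hpos : 0 < (A : GL (Fin 2) ℝ).val.det := A.2
  have := det_inv_mul_det A
  nlinarith

end TranslationStructure

/-! ### Real fields of degree at most two -/

section Quadratic

/-- A real field of degree at most two over `ℚ` is generated by the square root of a positive
integer. -/
theorem IntermediateField.exists_eq_adjoin_sqrt (K : IntermediateField ℚ ℝ) [FiniteDimensional ℚ K]
    (hK : Module.finrank ℚ K ≤ 2) : ∃ d : ℕ, 0 < d ∧ K = ℚ⟮√(d : ℝ)⟯ := by
  by_cases hbot : K = ⊥
  · refine ⟨1, one_pos, ?_⟩
    simp [hbot, IntermediateField.adjoin_one]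
  -- Degree at most two leaves no room between `ℚ` and K, so any irrational element generates.
  have hgen : ∀ β ∈ K, β ∉ (⊥ : IntermediateField ℚ ℝ) → K = ℚ⟮β⟯ := by
    intro β hβ hβ'
    have hle : ℚ⟮β⟯ ≤ K := by simpa [IntermediateField.adjoin_simple_le_iff] using hβ
    refine (IntermediateField.eq_of_le_of_finrank_le hle ?_).symm
    have : FiniteDimensional ℚ ℚ⟮β⟯ :=
      Module.Finite.of_injective (IntermediateField.inclusion hle).toLinearMap
        (IntermediateField.inclusion_injective hle)
    have hpos : 0 < Module.finrank ℚ ℚ⟮β⟯ := Module.finrank_pos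
    have hne : Module.finrank ℚ ℚ⟮β⟯ ≠ 1 := fun h =>
      hβ' (IntermediateField.finrank_adjoin_simple_eq_one_iff.1 h)
    omega
  obtain ⟨α, hα, hα'⟩ : ∃ α ∈ K, α ∉ (⊥ : IntermediateField ℚ ℝ) := by
    by_contra! h
    exact hbot (le_bot_iff.1 h)
  have hint : IsIntegral ℚ α := (IsIntegral.of_finite ℚ (⟨α, hα⟩ : K)).map K.val
  have hdeg : (minpoly ℚ α).natDegree = 2 := by
    rw [← IntermediateField.adjoin.finrank hint, ← hgen α hα hα']
    have hpos : 0 < Module.finrank ℚ K := Module.finrank_pos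
    have hne : Module.finrank ℚ K ≠ 1 := fun h => hbot (IntermediateField.finrank_eq_one_iff.1 h)
    omega
  obtain ⟨b, c, hbc⟩ : ∃ b c : ℚ, α ^ 2 + b * α + c = 0 := by
    refine ⟨(minpoly ℚ α).coeff 1, (minpoly ℚ α).coeff 0, ?_⟩
    have h := minpoly.aeval ℚ α
    rw [Polynomial.aeval_eq_sum_range, hdeg] at h
    have hm : (minpoly ℚ α).coeff 2 = 1 := by
      have := (minpoly.monic hint).coeff_natDegree
      rwa [hdeg] at this
    simp [Finset.sum_range_succ, hm, Rat.smul_def] at h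
    linarith
  set D : ℚ := b ^ 2 - 4 * c with hD
  -- Since `(2α + b)² = D`, multiplying by the denominator makes `γ² = D.num * D.den` an integer,
  -- which is the d sought.
  set γ : ℝ := D.den * (2 * α + b) with hγ
  have hden : (D.den : ℝ) ≠ 0 := by exact_mod_cast D.den_nz
  have hrat : ∀ q : ℚ, ∀ M : IntermediateField ℚ ℝ, (q : ℝ) ∈ M := fun q M => M.algebraMap_mem q
  have hγK : γ ∈ K := by
    refine K.mul_mem (K.natCast_mem _) (K.add_mem (K.mul_mem (ofNat_mem K 2) hα) (hrat b K))
  have hγbot : γ ∉ (⊥ : IntermediateField ℚ ℝ) := by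
    intro h
    apply hα'
    have : α = (γ / (D.den : ℝ) - (b : ℝ)) / 2 := by
      rw [hγ]; field_simp; ring
    rw [this]
    exact div_mem (sub_mem (div_mem h (natCast_mem _ _)) (hrat b _)) (ofNat_mem _ 2)
  have hγ0 : γ ≠ 0 := fun h => hγbot (h ▸ zero_mem _)
  have hDq : (D : ℝ) * D.den = D.num := by exact_mod_cast Rat.mul_den_eq_num D
  have hsq : γ ^ 2 = (D.num : ℝ) * D.den := by
    have h1 : (2 * α + b) ^ 2 = (D : ℝ) := by
      rw [hD]; push_cast; linear_combination 4 * hbc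
    rw [hγ, mul_pow, h1, ← hDq]; ring
  have hnum : 0 < D.num := by
    have h1 : 0 < (D.num : ℝ) * D.den := by rw [← hsq]; positivity
    have h2 : (0 : ℝ) < D.den := by exact_mod_cast D.pos
    exact_mod_cast pos_of_mul_pos_left h1 h2.le
  refine ⟨D.num.toNat * D.den, Nat.mul_pos (by omega) D.pos, ?_⟩
  have hcast : ((D.num.toNat * D.den : ℕ) : ℝ) = γ ^ 2 := by
    rw [hsq]
    push_cast
    congr 1
    exact_mod_cast congrArg (Int.cast (R := ℝ)) (Int.toNat_of_nonneg hnum.le)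
  rw [hcast, Real.sqrt_sq_eq_abs]
  refine hgen _ ?_ ?_
  · rcases abs_choice γ with h | h <;> rw [h]
    exacts [hγK, neg_mem hγK]
  · rcases abs_choice γ with h | h <;> rw [h]
    exacts [hγbot, fun h' => hγbot (by simpa using neg_mem h')]

end Quadratic

/-! ### The rational span of the periods and its real multipliers -/

section Span

/-- The `ℚ`-span of the image of a `ℤ`-linear map from a module of positive finite rank has at most
that dimension. -/
theorem finrank_span_range_le {H : Type u} [AddCommGroup H] [Module ℤ H] {n : ℕ} (hn : n ≠ 0)
    (hH : Module.finrank ℤ H = n) {V : Type*} [AddCommGroup V] [Module ℚ V] (p : H →ₗ[ℤ] V) :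
    FiniteDimensional ℚ (Submodule.span ℚ (range p)) ∧
      Module.finrank ℚ (Submodule.span ℚ (range p)) ≤ n := by
  obtain ⟨b, hb, hspan, hli⟩ := exists_linearIndependent ℚ (range p)
  -- Needs `n ≠ 0`: `finrank` is also 0 for infinite rank.
  have hrank : Module.rank ℤ H = n := (Cardinal.toNat_eq_iff hn).1 hH
  choose g hg using fun x : b => hb x.2
  have hliH : LinearIndependent ℤ g := by
    refine LinearIndependent.of_comp p ?_
    have : p ∘ g = ((↑) : b → V) := funext hg
    rw [this]
    exact hli.restrict_scalars' ℤ
  have hcard := hliH.cardinal_lift_le_rank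
  rw [hrank, Cardinal.lift_natCast, Cardinal.lift_le_nat_iff] at hcard
  have hfin : b.Finite := Cardinal.lt_aleph0_iff_set_finite.1
    (hcard.trans_lt (Cardinal.natCast_lt_aleph0))
  rw [← hspan]
  have := hfin.to_subtype
  have := Fintype.ofFinite b
  refine ⟨FiniteDimensional.span_of_finite ℚ hfin, ?_⟩
  have h1 := finrank_span_eq_card hli
  rw [Subtype.range_coe] at h1
  rw [h1]
  rw [Cardinal.mk_fintype] at hcard
  exact_mod_cast hcard

/-- The real numbers that stabilize a finite dimensional rational subspace of `ℂ`. -/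
def realMultipliers (L : Submodule ℚ ℂ) [FiniteDimensional ℚ L] : IntermediateField ℚ ℝ where
  carrier := {t | ∀ z ∈ L, t • z ∈ L}
  mul_mem' := fun {s t} hs ht z hz => by rw [mul_smul]; exact hs _ (ht _ hz)
  add_mem' := fun {s t} hs ht z hz => by rw [add_smul]; exact L.add_mem (hs _ hz) (ht _ hz)
  algebraMap_mem' := fun q z hz => by
    rw [algebraMap_smul]
    exact L.smul_mem q hz
  inv_mem' := fun t ht => by
    by_cases h0 : t = 0
    · simp [h0]
    let m : ℂ →ₗ[ℚ] ℂ := (LinearMap.lsmul ℝ ℂ t).restrictScalars ℚ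
    have hm : ∀ z ∈ L, m z ∈ L := ht
    -- On the finite-dimensional L, injective multiplication by t is surjective, so `t⁻¹` preserves
    -- L too.
    have hinj : Function.Injective (m.restrict hm) := by
      intro z w h
      have h1 : t • (z : ℂ) = t • (w : ℂ) := congrArg Subtype.val h
      exact Subtype.ext (smul_right_injective ℂ h0 h1)
    intro z hz
    obtain ⟨w, hw⟩ := LinearMap.surjective_of_injective hinj ⟨z, hz⟩
    have h1 : t • (w : ℂ) = z := congrArg Subtype.val hw
    rw [← h1, inv_smul_smul₀ h0]
    exact w.2

theorem mem_realMultipliers {L : Submodule ℚ ℂ} [FiniteDimensional ℚ L] {t : ℝ} :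
    t ∈ realMultipliers L ↔ ∀ z ∈ L, t • z ∈ L :=
  Iff.rfl

/-- As v and w are independent over `ℝ`, `(s, t) ↦ sv + tw` embeds two copies of the multiplier
field in L; injectivity is Cramer's rule. -/
theorem finrank_realMultipliers {L : Submodule ℚ ℂ} [FiniteDimensional ℚ L] {v w : ℂ} (hv : v ∈ L)
    (hw : w ∈ L) (hvw : v.re * w.im - v.im * w.re ≠ 0) :
    FiniteDimensional ℚ (realMultipliers L) ∧
      2 * Module.finrank ℚ (realMultipliers L) ≤ Module.finrank ℚ L := by
  let m (u : L) : realMultipliers L →ₗ[ℚ] L :=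
    { toFun := fun t => ⟨(t : ℝ) • (u : ℂ), t.2 _ u.2⟩
      map_add' := fun s t => Subtype.ext (add_smul _ _ _)
      map_smul' := fun q t => Subtype.ext (smul_assoc q (t : ℝ) (u : ℂ)) }
  let M : realMultipliers L × realMultipliers L →ₗ[ℚ] L := (m ⟨v, hv⟩).coprod (m ⟨w, hw⟩)
  have hM : Function.Injective M := by
    rw [← LinearMap.ker_eq_bot, LinearMap.ker_eq_bot']
    rintro ⟨s, t⟩ h
    have h1 : (s : ℝ) • v + (t : ℝ) • w = 0 := congrArg Subtype.val h
    have hre := congrArg Complex.re h1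
    have him := congrArg Complex.im h1
    simp at hre him
    have hs : (s : ℝ) * (v.re * w.im - v.im * w.re) = 0 := by
      linear_combination w.im * hre - w.re * him
    have ht : (t : ℝ) * (v.re * w.im - v.im * w.re) = 0 := by
      linear_combination v.re * him - v.im * hre
    refine Prod.ext (Subtype.ext ?_) (Subtype.ext ?_)
    · exact (mul_eq_zero.1 hs).resolve_right hvw
    · exact (mul_eq_zero.1 ht).resolve_right hvw
  have : FiniteDimensional ℚ (realMultipliers L × realMultipliers L) :=
    Module.Finite.of_injective M hM
  have hfin : FiniteDimensional ℚ (realMultipliers L) :=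
    Module.Finite.of_surjective (LinearMap.fst ℚ _ (realMultipliers L)) Prod.fst_surjective
  refine ⟨hfin, ?_⟩
  have := LinearMap.finrank_le_finrank_of_injective hM
  rw [Module.finrank_prod] at this
  omega

end Span

/-! ### Traces as multipliers, and the conclusion -/

namespace TranslationStructure

variable {X : Type u} [TopologicalSpace X]

/-- Cayley–Hamilton: in determinant one the inverse is the adjugate, and a matrix plus its adjugate
is the scalar `tr A`. -/
theorem trace_smul_eq {A : GL(2, ℝ)⁺} (hA : (A : GL (Fin 2) ℝ).val.det = 1) (z : ℂ) :
    Matrix.trace (A : GL (Fin 2) ℝ).val • z = planeMap (A : GL (Fin 2) ℝ) z +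
      planeMap ((A⁻¹ : GL(2, ℝ)⁺) : GL (Fin 2) ℝ) z := by
  have h : (((A⁻¹ : GL(2, ℝ)⁺) : GL (Fin 2) ℝ) : Matrix (Fin 2) (Fin 2) ℝ) =
      (A : GL (Fin 2) ℝ).val.adjugate := by
    rw [Subgroup.coe_inv, Matrix.coe_units_inv, Matrix.inv_def, hA]
    simp
  rw [h, Matrix.adjugate_fin_two]
  apply Complex.ext <;> simp [planeMap, Matrix.trace_fin_two] <;> ring

/-- The periods contain a real basis of the plane. -/
theorem exists_period_basis [T1Space X] [CompactSpace X] [ConnectedSpace X]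
    (T : TranslationStructure X) : ∃ a b,
      (T.period a).re * (T.period b).im - (T.period a).im * (T.period b).re ≠ 0 := by
  obtain ⟨a, ha⟩ := T.exists_period_ne_zero Complex.reLm (fun h => by
    simpa using LinearMap.congr_fun h 1)
  -- The functional is `z ↦ det(period a, z)`, nonzero because its value at `I` is the real part of
  -- `period a`.
  obtain ⟨b, hb⟩ := T.exists_period_ne_zero
    ((T.period a).re • Complex.imLm - (T.period a).im • Complex.reLm) (fun h => by
      have := LinearMap.congr_fun h Complex.I
      exact ha (by simpa using this))
  exact ⟨a, b, by simpa using hb⟩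

end TranslationStructure

end

theorem mainTheorem1 {X : Type u} [TopologicalSpace X] [T2Space X] [CompactSpace X]
    [ConnectedSpace X] (T : TranslationStructure X) (hgenus : HasGenus X 2) :
    ∃ d : ℕ, 0 < d ∧ traceField T.veechGroup = ℚ⟮√(d : ℝ)⟯ := by
  have hrank : Module.finrank ℤ (singularH1 X) = 2 * 2 := hgenus
  obtain ⟨hfin, hdim⟩ := finrank_span_range_le (show 2 * 2 ≠ 0 by norm_num) hrank T.period
  obtain ⟨a, b, hab⟩ := T.exists_period_basis
  obtain ⟨hS, hS2⟩ := finrank_realMultipliers (Submodule.subset_span ⟨a, rfl⟩)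
    (Submodule.subset_span ⟨b, rfl⟩) hab (L := Submodule.span ℚ (Set.range T.period))
  have hle : traceField T.veechGroup ≤ realMultipliers (Submodule.span ℚ (Set.range T.period)) := by
    refine IntermediateField.adjoin_le_iff.2 ?_
    rintro _ ⟨A, hA, rfl⟩
    refine mem_realMultipliers.2 fun z hz => ?_
    induction hz using Submodule.span_induction with
    | mem z hz =>
      rw [TranslationStructure.trace_smul_eq (T.det_eq_one hA)]
      exact Submodule.add_mem _
        (Submodule.subset_span (T.planeMap_mem_range_period hA hz))
        (Submodule.subset_span (T.planeMap_mem_range_period (inv_mem hA) hz))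
    | zero => simp
    | add z w _ _ hz hw => rw [smul_add]; exact Submodule.add_mem _ hz hw
    | smul q z _ hz => rw [smul_comm]; exact Submodule.smul_mem _ q hz
  have hinj := IntermediateField.inclusion_injective hle
  have : FiniteDimensional ℚ (traceField T.veechGroup) :=
    Module.Finite.of_injective (IntermediateField.inclusion hle).toLinearMap hinj
  refine IntermediateField.exists_eq_adjoin_sqrt _ ?_
  have := LinearMap.finrank_le_finrank_of_injective
    (f := (IntermediateField.inclusion hle).toLinearMap) hinj
  -- The trace field has degree at most that of the multiplier field, whose double is at most `dim L
  -- ≤ 4`.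
  omega
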